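/- Let $N\ge 0$ be an integer, let $E_{ij}$ be the matrix units of $M_N(\mathbb C)$, and let $\mathcal L:M_N(\mathbb C)\to M_N(\mathbb C)$ be the generator of a quantum dynamical semigroup (QDS): there is a family $(T_t)_{t\ge 0}$ of completely positive, trace preserving linear maps on $M_N(\mathbb C)$ with $T_0=\mathrm{id}$, $T_{t+s}=T_tT_s$ and $t\mapsto T_t(A)$ continuous for every $A$, such that $\mathcal L(x)=\lim_{t\downarrow 0}\frac1t(T_t(x)-x)$ for all $x$. Consider expressions of $\mathcal L$ in the standard basis, \[\mathcal L(\rho)=-i[\widetilde H,\rho]+\frac12\sum_{i,j,k,\ell=1}^N\gamma_{ijk\ell}\big([E_{ij},\rho E_{k\ell}^*]+[E_{ij}\rho,E_{k\ell}^*]\big),\] where $\widetilde H$ is Hermitian and the operator $\Gamma$ on $M_N(\mathbb C)$ given by $\Gamma(E_{k\ell})=\sum_{i,j}\gamma_{ijk\ell}E_{ij}$ satisfies: $\operatorname{Tr}(A^*\Gamma(A))\ge 0$ for all traceless $A$, and $\operatorname{Re}\operatorname{Tr}(\Gamma(A))=\operatorname{Re}\operatorname{Tr}(\Gamma(I_N)A)$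 for all Hermitian $A$. Such an expression exists, the numbers $\gamma_{ij}:=\gamma_{ijij}$ $(i\ne j)$ are nonnegative and do not depend on its choice, and so they define a weighted digraph $G_{\mathcal L}$ on the vertices $1,\dots,N$, in which the edge from $j$ to $i$ $(i\neq j)$ has weight $w_{ij}=\gamma_{ij}$ and is present if and only if $\gamma_{ij}>0$. Let $G^1,\dots,G^k$ be the terminal strongly connected components (TSCCs) of $G_{\mathcal L}$, i.e. the maximal strongly connected subdigraphs from which no path leads to another strongly connected component. For $1\le n\le k$ and each vertex $i$ of $G^n$ let \[\widetilde\rho^{\,G^n}_i=\sum_{T}\ \prod_{(a\to b)\in E(T)}w_{ba},\] where $T$ runs over the directed spanning subtrees of $G^n$ rooted at $i$, that is, the subdigraphs of $G^n$ containing all its vertices whose underlying undirected (multi)graph is a tree and in which $i$ is the only vertex without out-edges; put $\widetilde\rho^{\,G^n}_i=0$ for $i\notin G^n$. Let $\rho^{G^n}=\widetilde\rho^{\,G^n}/\sum_j\widetilde\rho_j^{\,G^n}$ and $d^{G^n}=\sum_{i=1}^N\rho_i^{G^n}E_{ii}$. Let $\mathcal D=\operatorname{Span}\{E_{nn}\}_{n=1}^N$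 be the diagonal subalgebra, $P_{\mathcal D}$ the orthogonal projection of $M_N(\mathbb C)$ (with the Hilbert--Schmidt inner product) onto $\mathcal D$, and $\mathcal L^{\mathcal D}=P_{\mathcal D}\mathcal L|_{\mathcal D}:\mathcal D\to\mathcal D$. Then \[\ker\mathcal L^{\mathcal D}=\operatorname{Span}\big(d^{G^n}\big)_{n=1}^k.\] -/

import Mathlib

open scoped NNReal Topology ComplexOrder Matrix

noncomputable section

/-! ### Quantum dynamical semigroups and their generators -/

/-- The ampliation `id_m ⊗ Φ`: apply `Φ` to each `N × N` block of an `m × m` block matrix. -/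
def ampliation {N : ℕ} (Φ : Module.End ℂ (Matrix (Fin N) (Fin N) ℂ)) (m : ℕ)
    (A : Matrix (Fin m × Fin N) (Fin m × Fin N) ℂ) :
    Matrix (Fin m × Fin N) (Fin m × Fin N) ℂ :=
  Matrix.of fun p q => Φ (Matrix.of fun k l => A (p.1, k) (q.1, l)) p.2 q.2

/-- `Φ` is completely positive: every ampliation preserves positive semidefiniteness. -/
def IsCompletelyPositive {N : ℕ} (Φ : Module.End ℂ (Matrix (Fin N) (Fin N) ℂ)) : Prop :=
  ∀ (m : ℕ) (A : Matrix (Fin m × Fin N) (Fin m × Fin N) ℂ),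
    A.PosSemidef → (ampliation Φ m A).PosSemidef

/-- A quantum dynamical semigroup (Schrödinger picture) on `M_N(ℂ)`. -/
structure IsQDS {N : ℕ} (T : ℝ≥0 → Module.End ℂ (Matrix (Fin N) (Fin N) ℂ)) : Prop where
  zero : T 0 = LinearMap.id
  add : ∀ t s, T (t + s) = T t ∘ₗ T s
  cont : ∀ A, Continuous fun t => T t A
  trace : ∀ t A, (T t A).trace = A.trace
  cp : ∀ t, IsCompletelyPositive (T t)

/-- `L` is the generator of some QDS `(T_t)`: `L x = lim_{t ↓ 0} (T_t x - x) / t`. -/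
def IsQDSGenerator {N : ℕ} (L : Module.End ℂ (Matrix (Fin N) (Fin N) ℂ)) : Prop :=
  ∃ T : ℝ≥0 → Module.End ℂ (Matrix (Fin N) (Fin N) ℂ), IsQDS T ∧
    ∀ x, Filter.Tendsto (fun t : ℝ≥0 => (t : ℝ)⁻¹ • (T t x - x)) (𝓝[>] 0) (𝓝 (L x))

/-! ### The form of a generator with respect to the standard basis -/

/-- The matrix unit `E_{ij}`. -/
def matUnit {N : ℕ} (i j : Fin N) : Matrix (Fin N) (Fin N) ℂ := Matrix.single i j 1

/-- The operator on `M_N(ℂ)` whose matrix in the standard basis is `Γ`: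
`Γ(E_{kl}) = ∑ γ_{ijkl} E_{ij}`. -/
def coeffAct {N : ℕ} (Γ : Matrix (Fin N × Fin N) (Fin N × Fin N) ℂ)
    (A : Matrix (Fin N) (Fin N) ℂ) : Matrix (Fin N) (Fin N) ℂ :=
  Matrix.of fun i j => ∑ k, ∑ l, Γ (i, j) (k, l) * A k l

/-- `L(ρ) = -i[H, ρ] + ½ ∑ γ_{ijkl} ([E_{ij}, ρ E_{kl}*] + [E_{ij} ρ, E_{kl}*])` with `H` Hermitian,
the compression of `Γ` to the traceless matrices positive semidefinite, and
`Re Tr(Γ(A)) = Re Tr(Γ(I) A)` for all Hermitian `A`. -/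
structure IsStandardForm {N : ℕ} (L : Module.End ℂ (Matrix (Fin N) (Fin N) ℂ))
    (H : Matrix (Fin N) (Fin N) ℂ) (Γ : Matrix (Fin N × Fin N) (Fin N × Fin N) ℂ) : Prop where
  hermitian : H.IsHermitian
  pos : ∀ A : Matrix (Fin N) (Fin N) ℂ, A.trace = 0 → 0 ≤ (Aᴴ * coeffAct Γ A).trace
  re_trace : ∀ A : Matrix (Fin N) (Fin N) ℂ, A.IsHermitian →
    (coeffAct Γ A).trace.re = (coeffAct Γ 1 * A).trace.re
  eq : ∀ ρ : Matrix (Fin N) (Fin N) ℂ, L ρ = -Complex.I • ⁅H, ρ⁆ +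
    (1 / 2 : ℂ) • ∑ i, ∑ j, ∑ k, ∑ l, Γ (i, j) (k, l) •
      (⁅matUnit i j, ρ * (matUnit k l)ᴴ⁆ + ⁅matUnit i j * ρ, (matUnit k l)ᴴ⁆)

/-! ### The compression to the diagonal subalgebra -/

/-- The diagonal subalgebra `𝓓 = Span {E_{nn}}`, as a subspace of `M_N(ℂ)`. -/
def diagSubspace (N : ℕ) : Submodule ℂ (Matrix (Fin N) (Fin N) ℂ) :=
  Submodule.span ℂ (Set.range fun n : Fin N => matUnit n n)

/-- The orthogonal (Hilbert–Schmidt) projection `A ↦ ∑ A_{nn} E_{nn}` of `M_N(ℂ)` onto `𝓓`. -/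
def diagProj (N : ℕ) : Matrix (Fin N) (Fin N) ℂ →ₗ[ℂ] diagSubspace N where
  toFun A := ∑ n, A n n • ⟨matUnit n n, Submodule.subset_span ⟨n, rfl⟩⟩
  map_add' A B := by simp [add_smul, Finset.sum_add_distrib]
  map_smul' c A := by simp [mul_smul, Finset.smul_sum]

/-- `L^𝓓 = P_𝓓 L|_𝓓`. -/
def diagPart {N : ℕ} (L : Module.End ℂ (Matrix (Fin N) (Fin N) ℂ)) :
    Module.End ℂ (diagSubspace N) :=
  diagProj N ∘ₗ L ∘ₗ (diagSubspace N).subtype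

/-! ### Weighted digraphs -/

/-- A weighted digraph on the vertices `Fin N`; `w i j` is the weight of the edge from `j` to `i`,
and is `0` exactly when there is no such edge. -/
@[ext] structure WeightedDigraph (N : ℕ) where
  w : Fin N → Fin N → ℝ
  nonneg : ∀ i j, 0 ≤ w i j
  loopless : ∀ i, w i i = 0

namespace WeightedDigraph

variable {N : ℕ} (G : WeightedDigraph N)

/-- There is an edge from `i` to `j`. -/
def Edge (i j : Fin N) : Prop := 0 < G.w j i

/-- The subdigraph induced on `S` is (nonempty and) strongly connected: any two vertices of `S` are
joined by a directed path that stays in `S`. -/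
def StronglyConnectedOn (S : Finset (Fin N)) : Prop :=
  S.Nonempty ∧ ∀ i ∈ S, ∀ j ∈ S,
    Relation.ReflTransGen (fun a b => a ∈ S ∧ b ∈ S ∧ G.Edge a b) i j

/-- `S` is the vertex set of a strongly connected component. -/
def IsSCC (S : Finset (Fin N)) : Prop := Maximal G.StronglyConnectedOn S

/-- `S ⪯ S'`: there is a directed path from some vertex of `S` to some vertex of `S'`. -/
def Precedes (S S' : Finset (Fin N)) : Prop :=
  ∃ i ∈ S, ∃ j ∈ S', Relation.ReflTransGen G.Edge i j

/-- `S` is the vertex set of a terminal strongly connected component. -/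
def IsTSCC (S : Finset (Fin N)) : Prop :=
  G.IsSCC S ∧ ∀ S', G.IsSCC S' → G.Precedes S S' → S = S'

/-- The undirected graph on `S` obtained from the directed edge set `T` by forgetting directions. -/
def underlying (S : Finset (Fin N)) (T : Finset (Fin N × Fin N)) : SimpleGraph S :=
  SimpleGraph.fromRel fun a b => ((a : Fin N), (b : Fin N)) ∈ T

/-- `T` is the edge set of a directed spanning subtree, rooted at `r`, of the subdigraph of `G`
induced on `S`; a pair `(a, b) ∈ T` is an edge from `a` to `b`. The field `oriented` says that
forgetting directions creates no double edge. -/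
structure IsRootedSpanningTree (S : Finset (Fin N)) (r : Fin N)
    (T : Finset (Fin N × Fin N)) : Prop where
  edge : ∀ a b, (a, b) ∈ T → a ∈ S ∧ b ∈ S ∧ G.Edge a b
  oriented : ∀ a b, (a, b) ∈ T → (b, a) ∉ T
  isTree : (underlying S T).IsTree
  root_mem : r ∈ S
  root : ∀ i ∈ S, (∀ j, (i, j) ∉ T) ↔ i = r

open scoped Classical in
/-- The total weight of the directed spanning subtrees of `G[S]` rooted at `i` (`0` if `i ∉ S`). -/
def treeWeight (S : Finset (Fin N)) (i : Fin N) : ℝ :=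
  ∑ T : Finset (Fin N × Fin N) with G.IsRootedSpanningTree S i T, ∏ e ∈ T, G.w e.2 e.1

/-- The vector of rooted spanning tree weights of `G[S]`, normalized to have entries of sum `1`. -/
def rho (S : Finset (Fin N)) (i : Fin N) : ℝ :=
  G.treeWeight S i / ∑ j, G.treeWeight S j

/-- The diagonal matrix `d = ∑ ρ_i E_{ii}` of the component `S`. -/
def diagMatrix (S : Finset (Fin N)) : Matrix (Fin N) (Fin N) ℂ :=
  ∑ i, (G.rho S i : ℂ) • matUnit i i

end WeightedDigraph

/-- `G` is the digraph of `L`: the edge from `j` to `i ≠ j` has weight `γ_{ij} = γ_{ijij}`, for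
a coefficient matrix `Γ` of `L` with respect to the standard basis. -/
def IsInducedDigraph {N : ℕ} (L : Module.End ℂ (Matrix (Fin N) (Fin N) ℂ))
    (G : WeightedDigraph N) : Prop :=
  ∃ H Γ, IsStandardForm L H Γ ∧ ∀ i j, i ≠ j → (G.w i j : ℂ) = Γ (i, j) (i, j)

end

/-! ### Rooted trees as self-maps -/

section RootedMaps

variable {V : Type*}

/-! The diagonal part of `L` generates a classical continuous-time Markov chain. For `i ≠ j` the
`(i,i)` entry of `L(E_jj)` is `γ_ijij` in every standard form (`IsStandardForm.coeff_eq`), and the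
vanishing trace of `L(E_ii)` fixes its `(i,i)` entry. So `L^𝓓` is "inflow minus outflow" on the
digraph, and its kernel is `stationary`.

Tree vectors are stationary by the Markov chain tree theorem (`sum_mul_rootedWeight`), applied
inside a terminal component, from which nothing leaks. Spanning trees are encoded as self-maps
flowing to the root; inflow and outflow at `i` then both count the maps with a single cycle, passing
through `i`.

Tree vectors span because the moduli of a stationary vector are again stationary
(`norm_stationary`), so its support is closed under following edges. Every vertex reaches a TSCC, so
a stationary vector that vanishes at one vertex of each TSCC is zero. Subtracting suitable multiples
of the tree vectors, which are positive on their components, achieves this vanishing.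

A standard form exists: take `H = 0` and the Choi matrix of `L`. Complete positivity makes it
positive on traceless matrices, and trace preservation removes the anticommutator terms. -/

/-- Every point is eventually mapped to `r` by `f`. -/
def FlowsTo (f : V → V) (r : V) : Prop := ∀ a, ∃ n : ℕ, f^[n] a = r

/-- Up to its first visit to `j`, an orbit never uses the value at `j`. -/
lemma exists_iterate_eq_of_agree {f g : V → V} {j : V} (h : ∀ a, a ≠ j → f a = g a) {n : ℕ} :
    ∀ {a : V}, f^[n] a = j → ∃ m : ℕ, g^[m] a = j := by
  induction n with
  | zero => exact fun ha => ⟨0, ha⟩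
  | succ n ih =>
    intro a ha
    by_cases haj : a = j
    · exact ⟨0, haj⟩
    · rw [Function.iterate_succ_apply, h a haj] at ha
      obtain ⟨m, hm⟩ := ih ha
      exact ⟨m + 1, by rwa [Function.iterate_succ_apply]⟩

lemma FlowsTo.of_agree {f g : V → V} {j : V} (hf : FlowsTo f j) (h : ∀ a, a ≠ j → f a = g a) :
    FlowsTo g j := fun a => by
  obtain ⟨n, hn⟩ := hf a
  exact exists_iterate_eq_of_agree h hn

lemma FlowsTo.trans {f : V → V} {i j : V} (hf : FlowsTo f i) {n : ℕ} (h : f^[n] i = j) :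
    FlowsTo f j := fun a => by
  obtain ⟨m, hm⟩ := hf a
  exact ⟨n + m, by rw [Function.iterate_add_apply, hm, h]⟩

lemma FlowsTo.mem_periodicPts {f : V → V} {j : V} (hj : FlowsTo f j) :
    j ∈ Function.periodicPts f := by
  obtain ⟨n, hn⟩ := hj (f j)
  exact ⟨n + 1, Nat.succ_pos n, by
    rw [Function.IsPeriodicPt, Function.IsFixedPt, Function.iterate_succ_apply, hn]⟩

/-- Breadth-first search: each point other than `r` is sent to a neighbour strictly closer to `r`.
-/
lemma exists_flowsTo {r : V} (E : V → V → Prop) (h : ∀ a, Relation.ReflTransGen E a r) :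
    ∃ f : V → V, FlowsTo f r ∧ f r = r ∧ ∀ a, a ≠ r → E a (f a) := by
  classical
  -- `layer n a` says that some path of length exactly `n` leads from `a` to `r`; the least such `n`
  -- is the distance.
  let layer : ℕ → V → Prop := fun n =>
    Nat.rec (motive := fun _ => V → Prop) (fun a => a = r) (fun _ P a => ∃ b, P b ∧ E a b) n
  have hl : ∀ a, ∃ n, layer n a := fun a => by
    induction h a using Relation.ReflTransGen.head_induction_on with
    | refl => exact ⟨0, rfl⟩
    | head hab _ ih =>
      obtain ⟨n, hn⟩ := ih
      exact ⟨n + 1, _, hn, hab⟩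
  have step : ∀ a, ∃ b : V, a ≠ r → E a b ∧ Nat.find (hl b) < Nat.find (hl a) := by
    intro a
    by_cases ha : a = r
    · exact ⟨a, absurd ha⟩
    have hs := Nat.find_spec (hl a)
    rcases Nat.eq_zero_or_pos (Nat.find (hl a)) with hz | hz
    · rw [hz] at hs
      exact absurd hs ha
    · obtain ⟨m, hm⟩ := Nat.exists_eq_succ_of_ne_zero hz.ne'
      rw [hm] at hs ⊢
      obtain ⟨b, hb, hab⟩ := hs
      exact ⟨b, fun _ => ⟨hab, Nat.lt_succ_of_le (Nat.find_min' _ hb)⟩⟩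
  choose g hg using step
  have key : ∀ n a, Nat.find (hl a) ≤ n → ∃ m, (Function.update g r r)^[m] a = r := by
    intro n
    induction n with
    | zero =>
      intro a ha
      by_cases har : a = r
      · exact ⟨0, har⟩
      · have := (hg a har).2
        omega
    | succ n ih =>
      intro a ha
      by_cases har : a = r
      · exact ⟨0, har⟩
      · obtain ⟨m, hm⟩ := ih (g a) (by have := (hg a har).2; omega)
        exact ⟨m + 1, by rwa [Function.iterate_succ_apply, Function.update_of_ne har]⟩
  exact ⟨Function.update g r r, fun a => key _ a le_rfl, by simp, fun a ha => by
    rw [Function.update_of_ne ha]; exact (hg a ha).1⟩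

variable [DecidableEq V]

lemma FlowsTo.update {f : V → V} {j : V} (hf : FlowsTo f j) (k : V) :
    FlowsTo (Function.update f j k) j :=
  hf.of_agree fun a ha => by rw [Function.update_of_ne ha]

variable [Fintype V] {R : Type*} [CommSemiring R]

open scoped Classical in
/-- The total weight of the self-maps that flow to the fixed point `r`, the weight being the product
of `w (f a) a` over `a ≠ r`. -/
noncomputable def rootedWeight (w : V → V → R) (r : V) : R :=
  ∑ f : V → V with FlowsTo f r ∧ f r = r, ∏ a ∈ Finset.univ.erase r, w (f a) a

-- Redirecting the root `i` to an arbitrary `k` turns a map rooted at `i` into an arbitrary map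
-- flowing to `i`, and resetting `i` to itself undoes this.
open scoped Classical in
lemma sum_mul_rootedWeight_out (w : V → V → R) (i : V) :
    ∑ k, w k i * rootedWeight w i = ∑ g : V → V with FlowsTo g i, ∏ a, w (g a) a := by
  simp only [rootedWeight, Finset.mul_sum]
  rw [Finset.sum_sigma']
  refine Finset.sum_bij' (fun p _ => Function.update p.2 i p.1)
    (fun g _ => ⟨g i, Function.update g i i⟩) ?_ ?_ ?_ ?_ ?_
  · rintro ⟨k, f⟩ h
    simp only [Finset.mem_sigma, Finset.mem_univ, Finset.mem_filter, true_and] at h ⊢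
    exact h.1.update k
  · intro g h
    simp only [Finset.mem_sigma, Finset.mem_univ, Finset.mem_filter, true_and] at h ⊢
    exact ⟨h.update i, by simp⟩
  · rintro ⟨k, f⟩ h
    simp only [Finset.mem_sigma, Finset.mem_univ, Finset.mem_filter, true_and] at h
    have : Function.update f i i = f := by
      conv_rhs => rw [← Function.update_eq_self i f, h.2]
    simp [this]
  · intro g _
    simp
  · rintro ⟨k, f⟩ _
    rw [← Finset.mul_prod_erase _ _ (Finset.mem_univ i), Function.update_self]
    congr 1
    refine Finset.prod_congr rfl fun a ha => ?_
    rw [Function.update_of_ne (Finset.ne_of_mem_erase ha)]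

-- Redirecting the root `j` to `i` closes a cycle through `i`. The inverse cuts this cycle at the
-- predecessor of `i`, which becomes the root.
open scoped Classical in
lemma sum_mul_rootedWeight_in (w : V → V → R) (i : V) :
    ∑ j, w i j * rootedWeight w j = ∑ g : V → V with FlowsTo g i, ∏ a, w (g a) a := by
  simp only [rootedWeight, Finset.mul_sum]
  rw [Finset.sum_sigma']
  refine Finset.sum_bij (fun p _ => Function.update p.2 p.1 i) ?_ ?_ ?_ ?_
  · rintro ⟨j, f⟩ h
    simp only [Finset.mem_sigma, Finset.mem_univ, Finset.mem_filter, true_and] at h ⊢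
    exact (h.1.update i).trans (n := 1) (by simp)
  · rintro ⟨j, f⟩ h ⟨j', f'⟩ h' heq
    simp only [Finset.mem_sigma, Finset.mem_univ, Finset.mem_filter, true_and] at h h' heq
    have hj := h.1.update i
    have hj' := h'.1.update i
    have hjj : j = j' := by
      rw [← heq] at hj'
      -- Both `j` and `j'` are periodic points sent to `i`, and a map is injective on its periodic
      -- points.
      refine (Function.bijOn_periodicPts _).injOn hj.mem_periodicPts
        hj'.mem_periodicPts ?_
      conv_rhs => rw [heq]
      simp
    subst hjj
    have : f = f' := by
      funext a
      by_cases ha : a = j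
      · rw [ha, h.2, h'.2]
      · simpa [Function.update_of_ne ha] using congrFun heq a
    rw [this]
  · intro g hg
    simp only [Finset.mem_filter, Finset.mem_univ, true_and] at hg
    -- The cycle through `i` returns after `n + 1` steps, so `g^[n] i` is the predecessor of `i` on
    -- it.
    obtain ⟨n, hn⟩ := hg (g i)
    have hj : g (g^[n] i) = i := by
      rw [← Function.iterate_succ_apply' g, Function.iterate_succ_apply, hn]
    refine ⟨⟨g^[n] i, Function.update g (g^[n] i) (g^[n] i)⟩, ?_, ?_⟩
    · simp only [Finset.mem_sigma, Finset.mem_univ, Finset.mem_filter, true_and]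
      exact ⟨(hg.trans rfl).update _, by simp⟩
    · simp only [Function.update_idem]
      conv_rhs => rw [← Function.update_eq_self (g^[n] i) g, hj]
  · rintro ⟨j, f⟩ _
    rw [← Finset.mul_prod_erase _ _ (Finset.mem_univ j), Function.update_self]
    congr 1
    refine Finset.prod_congr rfl fun a ha => ?_
    rw [Function.update_of_ne (Finset.ne_of_mem_erase ha)]

/-- The Markov chain tree theorem: the rooted tree weights are a stationary vector. -/
theorem sum_mul_rootedWeight (w : V → V → R) (i : V) :
    ∑ j, w i j * rootedWeight w j = (∑ k, w k i) * rootedWeight w i := by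
  rw [Finset.sum_mul, sum_mul_rootedWeight_in, sum_mul_rootedWeight_out]

end RootedMaps

namespace WeightedDigraph

variable {N : ℕ} (G : WeightedDigraph N) {S : Finset (Fin N)}

/-! ### Rooted spanning trees as self-maps -/

/-- The edges `(a, f a)`, `a ≠ r`. -/
def mapEdges (f : S → S) (r : S) : Finset (Fin N × Fin N) :=
  (Finset.univ.erase r).image fun a : S => ((a : Fin N), (f a : Fin N))

lemma mem_mapEdges {f : S → S} {r a b : S} :
    ((a : Fin N), (b : Fin N)) ∈ mapEdges f r ↔ a ≠ r ∧ f a = b := by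
  simp only [mapEdges, Finset.mem_image, Finset.mem_erase, Finset.mem_univ, and_true,
    Prod.mk.injEq]
  constructor
  · rintro ⟨c, hc, h1, h2⟩
    obtain rfl := Subtype.ext h1
    exact ⟨hc, Subtype.ext h2⟩
  · rintro ⟨h, rfl⟩
    exact ⟨a, h, rfl, rfl⟩

lemma exists_of_mem_mapEdges {f : S → S} {r : S} {a b : Fin N} (h : (a, b) ∈ mapEdges f r) :
    ∃ c : S, c ≠ r ∧ a = c ∧ b = f c := by
  simp only [mapEdges, Finset.mem_image, Finset.mem_erase, Finset.mem_univ, and_true,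
    Prod.mk.injEq] at h
  obtain ⟨c, hc, h1, h2⟩ := h
  exact ⟨c, hc, h1.symm, h2.symm⟩

lemma prod_mapEdges (f : S → S) (r : S) (w : Fin N → Fin N → ℝ) :
    ∏ e ∈ mapEdges f r, w e.2 e.1 = ∏ a ∈ Finset.univ.erase r, w (f a) a :=
  Finset.prod_image fun _ _ _ _ h => Subtype.ext (congrArg Prod.fst h)

lemma mapEdges_injOn (r : S) : Set.InjOn (fun f => mapEdges f r) {f : S → S | f r = r} := by
  intro f hf g hg h
  funext a
  by_cases ha : a = r
  · rw [ha]; exact Eq.trans hf (Eq.symm hg)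
  · have h1 : ((a : Fin N), (f a : Fin N)) ∈ mapEdges f r := mem_mapEdges.2 ⟨ha, rfl⟩
    rw [show mapEdges f r = mapEdges g r from h, mem_mapEdges] at h1
    exact h1.2.symm

/-- Flowing to `r` gives connectedness, and the edges `s(a, f a)` with `a ≠ r` number at most `|S| -
1`, which forces a tree. -/
lemma isRootedSpanningTree_mapEdges {f : S → S} {r : S} (hf : FlowsTo f r) (hr : f r = r)
    (hE : ∀ a, a ≠ r → G.Edge a (f a)) : G.IsRootedSpanningTree S r (mapEdges f r) := by
  have hne : ∀ a, a ≠ r → f a ≠ a := by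
    intro a ha h
    obtain ⟨n, hn⟩ := hf a
    exact ha (by rw [← hn, Function.iterate_fixed h])
  have hadj : ∀ a, a ≠ r → (underlying S (mapEdges f r)).Adj a (f a) := fun a ha => by
    rw [underlying, SimpleGraph.fromRel_adj]
    exact ⟨(hne a ha).symm, Or.inl (mem_mapEdges.2 ⟨ha, rfl⟩)⟩
  have hreach : ∀ n a, f^[n] a = r → (underlying S (mapEdges f r)).Reachable a r := by
    intro n
    induction n with
    | zero => rintro a rfl; rfl
    | succ n ih =>
      intro a ha
      by_cases har : a = r
      · rw [har]
      · exact (hadj a har).reachable.trans (ih _ ha)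
  have hconn : (underlying S (mapEdges f r)).Connected := by
    have : Nonempty S := ⟨r⟩
    refine ⟨fun a b => ?_⟩
    obtain ⟨n, hn⟩ := hf a
    obtain ⟨m, hm⟩ := hf b
    exact (hreach n a hn).trans (hreach m b hm).symm
  refine ⟨?_, ?_, ?_, r.2, ?_⟩
  · intro a b h
    obtain ⟨c, hc, rfl, rfl⟩ := exists_of_mem_mapEdges h
    exact ⟨c.2, (f c).2, hE c hc⟩
  · intro a b h h'
    obtain ⟨c, hc, rfl, rfl⟩ := exists_of_mem_mapEdges h
    obtain ⟨-, h2⟩ := mem_mapEdges.1 h'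
    obtain ⟨n, hn⟩ := hf c
    -- A double edge would be a 2-cycle; its orbit must hit `r`, which is a fixed point.
    have hper : Function.IsPeriodicPt f 2 c := h2
    have hlt := Nat.mod_lt n (y := 2) (by norm_num)
    rw [← hper.iterate_mod_apply] at hn
    interval_cases n % 2
    · exact hc hn
    · exact hc (h2.symm.trans ((congrArg f hn).trans hr))
  · rw [SimpleGraph.isTree_iff_connected_and_card]
    refine ⟨hconn, le_antisymm ?_ hconn.card_vert_le_card_edgeSet_add_one⟩
    have hsub : (underlying S (mapEdges f r)).edgeSet ⊆
        ((Finset.univ.erase r).image fun a => s(a, f a) : Finset (Sym2 S)) := by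
      intro e
      induction e with
      | _ a b =>
        rw [SimpleGraph.mem_edgeSet, underlying, SimpleGraph.fromRel_adj]
        rintro ⟨-, h | h⟩ <;> obtain ⟨h1, h2⟩ := mem_mapEdges.1 h <;>
          simp only [Finset.coe_image, Set.mem_image, Finset.mem_coe, Finset.mem_erase,
            Finset.mem_univ, and_true]
        · exact ⟨a, h1, by rw [h2]⟩
        · exact ⟨b, h1, by rw [h2, Sym2.eq_swap]⟩
    have h1 := Set.ncard_le_ncard hsub (Finset.finite_toSet _)
    rw [Set.ncard_coe_finset] at h1
    have h2 := h1.trans Finset.card_image_le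
    rw [Finset.card_erase_of_mem (Finset.mem_univ r), Finset.card_univ] at h2
    have h3 : 0 < Fintype.card S := Fintype.card_pos_iff.2 ⟨r⟩
    rw [Nat.card_eq_fintype_card (α := S)]
    rw [← Nat.card_coe_set_eq] at h2
    omega
  · intro i hi
    constructor
    · intro h
      by_contra hir
      exact h (f ⟨i, hi⟩) ((mem_mapEdges (a := ⟨i, hi⟩)).2
        ⟨fun h => hir (congrArg Subtype.val h), rfl⟩)
    · rintro rfl j h
      obtain ⟨c, hc, h1, -⟩ := exists_of_mem_mapEdges h
      exact hc (Subtype.ext h1.symm)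

variable {G}

lemma IsRootedSpanningTree.card_le {r : S} {T : Finset (Fin N × Fin N)}
    (hT : G.IsRootedSpanningTree S r T) : T.card ≤ Fintype.card S - 1 := by
  classical
  have htree := (SimpleGraph.isTree_iff_connected_and_card.1 hT.isTree).2
  rw [Nat.card_eq_fintype_card (α := S)] at htree
  let φ : T → (underlying S T).edgeSet := fun e =>
    ⟨s(⟨e.1.1, (hT.edge _ _ e.2).1⟩, ⟨e.1.2, (hT.edge _ _ e.2).2.1⟩), by
      rw [SimpleGraph.mem_edgeSet, underlying, SimpleGraph.fromRel_adj]
      obtain ⟨⟨a, b⟩, he⟩ := e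
      refine ⟨fun h => ?_, Or.inl he⟩
      obtain rfl : a = b := congrArg Subtype.val h
      exact hT.oriented a a he he⟩
  have hφ : Function.Injective φ := by
    rintro ⟨⟨a, b⟩, h⟩ ⟨⟨c, d⟩, h'⟩ heq
    have := congrArg Subtype.val heq
    simp only [φ, Sym2.eq_iff, Subtype.mk.injEq] at this
    obtain ⟨rfl, rfl⟩ | ⟨rfl, rfl⟩ := this
    · rfl
    · exact absurd h' (hT.oriented _ _ h)
  have := Nat.card_le_card_of_injective φ hφ
  rw [Nat.card_eq_fintype_card, Fintype.card_coe] at this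
  omega

/-- One chosen out-edge at each non-root vertex already gives `|S| - 1` edges, as many as `T` can
have, so `T` contains no others. -/
lemma IsRootedSpanningTree.exists_map {r : S} {T : Finset (Fin N × Fin N)}
    (hT : G.IsRootedSpanningTree S r T) :
    ∃ f : S → S, (FlowsTo f r ∧ f r = r) ∧ (∀ a, a ≠ r → G.Edge a (f a)) ∧ mapEdges f r = T := by
  classical
  have hout : ∀ a : S, ∃ b : S, a ≠ r → ((a : Fin N), (b : Fin N)) ∈ T := by
    intro a
    by_cases ha : a = r
    · exact ⟨a, absurd ha⟩
    · have := mt (hT.root a a.2).1 fun h => ha (Subtype.ext h)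
      push Not at this
      obtain ⟨j, hj⟩ := this
      exact ⟨⟨j, (hT.edge _ _ hj).2.1⟩, fun _ => hj⟩
  choose g hg using hout
  set f := Function.update g r r with hf
  have hfr : f r = r := by simp [hf]
  have hfT : ∀ a, a ≠ r → ((a : Fin N), (f a : Fin N)) ∈ T := fun a ha => by
    rw [hf, Function.update_of_ne ha]; exact hg a ha
  have hmap : mapEdges f r = T := by
    refine Finset.eq_of_subset_of_card_le ?_ ?_
    · rintro ⟨a, b⟩ h
      obtain ⟨c, hc, rfl, rfl⟩ := exists_of_mem_mapEdges h
      exact hfT c hc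
    · refine hT.card_le.trans ?_
      rw [mapEdges, Finset.card_image_of_injective _
        (fun _ _ h => Subtype.ext (congrArg Prod.fst h)),
        Finset.card_erase_of_mem (Finset.mem_univ r), Finset.card_univ]
  refine ⟨f, ⟨fun a => ?_, hfr⟩, fun a ha => (hT.edge _ _ (hfT a ha)).2.2, hmap⟩
  -- Flowing to `r` passes across an undirected edge either way: one step is added or removed.
  -- Induction along a walk to `r` then suffices.
  have hadj : ∀ b c, (underlying S T).Adj b c → (∃ n, f^[n] c = r) → ∃ n, f^[n] b = r := by
    rintro b c h ⟨n, hn⟩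
    rw [underlying, SimpleGraph.fromRel_adj, ← hmap, mem_mapEdges, mem_mapEdges] at h
    obtain ⟨-, ⟨-, rfl⟩ | ⟨-, rfl⟩⟩ := h
    · exact ⟨n + 1, hn⟩
    · cases n with
      | zero => exact ⟨0, by rw [Function.iterate_zero_apply] at hn ⊢; rw [hn, hfr]⟩
      | succ n => exact ⟨n, hn⟩
  have hwalk : ∀ b c, (underlying S T).Walk b c → (∃ n, f^[n] c = r) → ∃ n, f^[n] b = r := by
    intro b c p
    induction p with
    | nil => exact id
    | cons h _ ih => exact fun hc => hadj _ _ h (ih hc)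
  obtain ⟨p⟩ := hT.isTree.connected a r
  exact hwalk a r p ⟨0, rfl⟩

lemma treeWeight_of_notMem {i : Fin N} (hi : i ∉ S) : G.treeWeight S i = 0 := by
  classical
  refine Finset.sum_eq_zero fun T hT => ?_
  exact absurd (Finset.mem_filter.1 hT).2.root_mem hi

lemma treeWeight_nonneg (i : Fin N) : 0 ≤ G.treeWeight S i :=
  Finset.sum_nonneg fun _ _ => Finset.prod_nonneg fun _ _ => G.nonneg _ _

/-- Maps that use a non-edge have weight zero, and the remaining ones correspond bijectively to
spanning trees. -/
lemma treeWeight_coe (r : S) :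
    G.treeWeight S r = rootedWeight (fun a b : S => G.w a b) r := by
  classical
  rw [treeWeight, rootedWeight]
  have : ∑ f : S → S with FlowsTo f r ∧ f r = r, ∏ a ∈ Finset.univ.erase r, G.w (f a) a =
      ∑ f : S → S with (FlowsTo f r ∧ f r = r) ∧ ∀ a, a ≠ r → G.Edge a (f a),
        ∏ a ∈ Finset.univ.erase r, G.w (f a) a := by
    refine (Finset.sum_subset (Finset.monotone_filter_right _ fun f _ h => h.1) ?_).symm
    intro f hf hf'
    simp only [Finset.mem_filter, Finset.mem_univ, true_and] at hf hf'
    have : ∃ a, a ≠ r ∧ ¬ G.Edge a (f a) := by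
      by_contra! h
      exact hf' ⟨hf, h⟩
    obtain ⟨a, ha, hE⟩ := this
    exact Finset.prod_eq_zero (Finset.mem_erase.2 ⟨ha, Finset.mem_univ a⟩)
      (le_antisymm (not_lt.1 hE) (G.nonneg _ _))
  rw [this]
  symm
  refine Finset.sum_bij (fun f _ => mapEdges f r) ?_ ?_ ?_ ?_
  · intro f hf
    simp only [Finset.mem_filter, Finset.mem_univ, true_and] at hf ⊢
    exact G.isRootedSpanningTree_mapEdges hf.1.1 hf.1.2 hf.2
  · intro f hf g hg h
    simp only [Finset.mem_filter, Finset.mem_univ, true_and] at hf hg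
    exact mapEdges_injOn r hf.1.2 hg.1.2 h
  · intro T hT
    simp only [Finset.mem_filter, Finset.mem_univ, true_and] at hT
    obtain ⟨f, h1, h2, h3⟩ := hT.exists_map
    exact ⟨f, Finset.mem_filter.2 ⟨Finset.mem_univ f, h1, h2⟩, h3⟩
  · intro f _
    exact (prod_mapEdges f r G.w).symm

lemma StronglyConnectedOn.treeWeight_pos (hS : G.StronglyConnectedOn S) {i : Fin N} (hi : i ∈ S) :
    0 < G.treeWeight S i := by
  classical
  have hpath : ∀ a b : S, Relation.ReflTransGen (fun a b : S => G.Edge a b) a b := by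
    rintro ⟨a, ha⟩ ⟨b, hb⟩
    have h := hS.2 a ha b hb
    induction h with
    | refl => exact .refl
    | tail _ h ih => exact (ih h.1).tail h.2.2
  obtain ⟨f, h1, h2, h3⟩ := exists_flowsTo (r := (⟨i, hi⟩ : S)) _ fun a => hpath a _
  have hT := G.isRootedSpanningTree_mapEdges h1 h2 h3
  refine Finset.sum_pos' (fun _ _ => Finset.prod_nonneg fun _ _ => G.nonneg _ _)
    ⟨_, Finset.mem_filter.2 ⟨Finset.mem_univ _, hT⟩, Finset.prod_pos fun e he => ?_⟩
  exact (hT.edge e.1 e.2 he).2.2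

end WeightedDigraph

namespace WeightedDigraph

/-! ### Strongly connected components -/

section Components

variable {N : ℕ} (G : WeightedDigraph N) {S : Finset (Fin N)}

open scoped Classical in
/-- The set of vertices in the same strongly connected component as `a`. -/
noncomputable def component (a : Fin N) : Finset (Fin N) :=
  {b | Relation.ReflTransGen G.Edge a b ∧ Relation.ReflTransGen G.Edge b a}

variable {G}

lemma mem_component {a b : Fin N} : b ∈ G.component a ↔
    Relation.ReflTransGen G.Edge a b ∧ Relation.ReflTransGen G.Edge b a := by
  simp [component]

lemma self_mem_component (a : Fin N) : a ∈ G.component a := mem_component.2 ⟨.refl, .refl⟩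

/-- A path between two vertices of the component cannot leave it: each intermediate vertex is
reachable from `a` and reaches `a`. -/
lemma stronglyConnectedOn_component (a : Fin N) : G.StronglyConnectedOn (G.component a) := by
  refine ⟨⟨a, self_mem_component a⟩, fun c hc d hd => ?_⟩
  rw [mem_component] at hc hd
  have h := hc.2.trans hd.1
  have hac := hc.1
  clear hc
  induction h using Relation.ReflTransGen.head_induction_on with
  | refl => exact .refl
  | head hxy hyd ih =>
    exact .head ⟨mem_component.2 ⟨hac, (hyd.trans hd.2).head hxy⟩,
      mem_component.2 ⟨hac.tail hxy, hyd.trans hd.2⟩, hxy⟩ (ih (hac.tail hxy))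

lemma StronglyConnectedOn.reachable (hS : G.StronglyConnectedOn S) {a b : Fin N} (ha : a ∈ S)
    (hb : b ∈ S) : Relation.ReflTransGen G.Edge a b :=
  Relation.ReflTransGen.mono (fun _ _ h => h.2.2) _ _ (hS.2 a ha b hb)

lemma StronglyConnectedOn.subset_component (hS : G.StronglyConnectedOn S) {a : Fin N}
    (ha : a ∈ S) : S ⊆ G.component a := fun _ hb =>
  mem_component.2 ⟨hS.reachable ha hb, hS.reachable hb ha⟩

lemma IsSCC.eq_component (hS : G.IsSCC S) {a : Fin N} (ha : a ∈ S) : S = G.component a :=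
  (hS.1.subset_component ha).antisymm
    (hS.2 (stronglyConnectedOn_component a) (hS.1.subset_component ha))

lemma isSCC_component (a : Fin N) : G.IsSCC (G.component a) :=
  ⟨stronglyConnectedOn_component a, fun _ hS h => hS.subset_component (h (self_mem_component a))⟩

lemma IsTSCC.mem_of_edge (hS : G.IsTSCC S) {a b : Fin N} (ha : a ∈ S) (hab : G.Edge a b) :
    b ∈ S := by
  rw [hS.2 _ (isSCC_component b) ⟨a, ha, b, self_mem_component b, .single hab⟩]
  exact self_mem_component b

/-- Among the vertices reachable from `a`, one with the fewest reachable vertices lies in a terminal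
component. -/
lemma exists_isTSCC_reachable (a : Fin N) :
    ∃ S, G.IsTSCC S ∧ ∃ b ∈ S, Relation.ReflTransGen G.Edge a b := by
  classical
  obtain ⟨b, hb, hmin⟩ := Finset.exists_min_image
    {b : Fin N | Relation.ReflTransGen G.Edge a b}
    (fun b => Finset.card {c : Fin N | Relation.ReflTransGen G.Edge b c})
    ⟨a, by simpa using Relation.ReflTransGen.refl⟩
  simp only [Finset.mem_filter, Finset.mem_univ, true_and] at hb hmin
  refine ⟨G.component b, ⟨isSCC_component b, ?_⟩, b, self_mem_component b, hb⟩
  rintro S hS ⟨i, hi, j, hj, hij⟩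
  have hbj : Relation.ReflTransGen G.Edge b j := (mem_component.1 hi).1.trans hij
  have heq := Finset.eq_of_subset_of_card_le
    (Finset.monotone_filter_right Finset.univ fun c _ h => hbj.trans h) (hmin j (hb.trans hbj))
  have hjb : Relation.ReflTransGen G.Edge j b := by
    have : b ∈ ({c : Fin N | Relation.ReflTransGen G.Edge b c} : Finset (Fin N)) := by
      simpa using Relation.ReflTransGen.refl
    rw [← heq] at this
    simpa using this
  rw [hS.eq_component hj]
  exact (isSCC_component b).eq_component (mem_component.2 ⟨hbj, hjb⟩)

end Components

/-! ### Stationary vectors -/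

section Stationary

variable {N : ℕ} (G : WeightedDigraph N) {S : Finset (Fin N)}

/-- The vectors `x` with `∑ⱼ w_ij x_j = (∑ₖ w_ki) x_i` for all `i`. -/
def stationary : Submodule ℂ (Fin N → ℂ) where
  carrier := {x | ∀ i, ∑ j, (G.w i j : ℂ) * x j = (∑ k, (G.w k i : ℂ)) * x i}
  zero_mem' := by simp
  add_mem' hx hy i := by
    simp only [Pi.add_apply, mul_add, Finset.sum_add_distrib, hx i, hy i]
  smul_mem' c x hx i := by
    simp only [Pi.smul_apply, smul_eq_mul, mul_left_comm _ c, ← Finset.mul_sum, hx i]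

variable {G}

lemma mem_stationary {x : Fin N → ℂ} : x ∈ G.stationary ↔
    ∀ i, ∑ j, (G.w i j : ℂ) * x j = (∑ k, (G.w k i : ℂ)) * x i := Iff.rfl

/-- The triangle inequality gives `≤` at each vertex. Summed over all vertices both sides count
every edge once, so equality holds throughout. -/
lemma norm_stationary {x : Fin N → ℂ} (hx : x ∈ G.stationary) (i : Fin N) :
    (∑ k, G.w k i) * ‖x i‖ = ∑ j, G.w i j * ‖x j‖ := by
  have hle : ∀ i ∈ Finset.univ, (∑ k, G.w k i) * ‖x i‖ ≤ ∑ j, G.w i j * ‖x j‖ := fun i _ => by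
    have h := congrArg norm (hx i)
    rw [norm_mul, ← Complex.ofReal_sum, Complex.norm_of_nonneg
      (Finset.sum_nonneg fun k _ => G.nonneg k i)] at h
    rw [← h]
    refine (norm_sum_le _ _).trans_eq (Finset.sum_congr rfl fun j _ => ?_)
    rw [norm_mul, Complex.norm_of_nonneg (G.nonneg i j)]
  refine (Finset.sum_eq_sum_iff_of_le hle).1 ?_ i (Finset.mem_univ i)
  simp only [Finset.sum_mul]
  exact Finset.sum_comm

lemma ne_zero_of_edge {x : Fin N → ℂ} (hx : x ∈ G.stationary) {i j : Fin N} (h : G.Edge i j)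
    (hi : x i ≠ 0) : x j ≠ 0 := by
  intro hj
  have h1 := norm_stationary hx j
  rw [hj, norm_zero, mul_zero, eq_comm, Finset.sum_eq_zero_iff_of_nonneg
    fun k _ => mul_nonneg (G.nonneg j k) (norm_nonneg _)] at h1
  exact (mul_pos h (norm_pos_iff.2 hi)).ne' (h1 i (Finset.mem_univ i))

lemma ne_zero_of_reachable {x : Fin N → ℂ} (hx : x ∈ G.stationary) {i j : Fin N}
    (h : Relation.ReflTransGen G.Edge i j) (hi : x i ≠ 0) : x j ≠ 0 := by
  induction h with
  | refl => exact hi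
  | tail _ h ih => exact ne_zero_of_edge hx h ih

lemma IsTSCC.w_eq_zero (hS : G.IsTSCC S) {i j : Fin N} (hj : j ∈ S) (hi : i ∉ S) :
    G.w i j = 0 :=
  le_antisymm (not_lt.1 fun h => hi (hS.mem_of_edge hj h)) (G.nonneg i j)

/-- Terminality makes the outflow computed inside `S` the full outflow and lets nothing enter the
vertices outside `S`. -/
lemma IsTSCC.sum_mul_treeWeight (hS : G.IsTSCC S) (i : Fin N) :
    ∑ j, G.w i j * G.treeWeight S j = (∑ k, G.w k i) * G.treeWeight S i := by
  have hsum : ∀ f : Fin N → ℝ, (∀ j, j ∉ S → f j = 0) → ∑ j, f j = ∑ j : S, f j := fun f hf => by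
    rw [Finset.sum_coe_sort S f]
    exact (Finset.sum_subset (Finset.subset_univ S) fun j _ => hf j).symm
  by_cases hi : i ∈ S
  · rw [hsum _ fun j hj => by rw [treeWeight_of_notMem hj, mul_zero],
      hsum _ fun k hk => hS.w_eq_zero hi hk]
    have h := sum_mul_rootedWeight (fun a b : S => G.w a b) ⟨i, hi⟩
    simpa only [← treeWeight_coe] using h
  · rw [treeWeight_of_notMem hi, mul_zero]
    refine Finset.sum_eq_zero fun j _ => ?_
    by_cases hj : j ∈ S
    · rw [hS.w_eq_zero hj hi, zero_mul]
    · rw [treeWeight_of_notMem hj, mul_zero]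

lemma IsTSCC.rho_mem_stationary (hS : G.IsTSCC S) : (fun i => (G.rho S i : ℂ)) ∈ G.stationary := by
  intro i
  have h := congrArg (fun r : ℝ => ((r / ∑ j, G.treeWeight S j : ℝ) : ℂ)) (hS.sum_mul_treeWeight i)
  simp only [Finset.sum_div, mul_div_assoc] at h
  simpa only [rho, Complex.ofReal_sum, Complex.ofReal_mul] using h

lemma StronglyConnectedOn.rho_ne_zero (hS : G.StronglyConnectedOn S) {i : Fin N} (hi : i ∈ S) :
    G.rho S i ≠ 0 :=
  (div_pos (hS.treeWeight_pos hi) (Finset.sum_pos' (fun j _ => treeWeight_nonneg j)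
    ⟨i, Finset.mem_univ i, hS.treeWeight_pos hi⟩)).ne'

lemma rho_of_notMem {i : Fin N} (hi : i ∉ S) : G.rho S i = 0 := by
  rw [rho, treeWeight_of_notMem hi, zero_div]

variable (G)

theorem stationary_eq_span :
    G.stationary = Submodule.span ℂ {x | ∃ S, G.IsTSCC S ∧ x = fun i => (G.rho S i : ℂ)} := by
  classical
  refine le_antisymm (fun x hx => ?_) (Submodule.span_le.2 ?_)
  · have hne : ∀ S : {S // G.IsTSCC S}, ∃ i, i ∈ S.1 := fun S => S.2.1.1.1
    choose i hi using hne
    -- The coefficients make `y` agree with `x` at the representative `i S` of each TSCC; distinct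
    -- components are disjoint.
    let y : Fin N → ℂ := ∑ S : {S // G.IsTSCC S},
      (x (i S) / G.rho S.1 (i S)) • fun j => (G.rho S.1 j : ℂ)
    have hy : y ∈ Submodule.span ℂ {x | ∃ S, G.IsTSCC S ∧ x = fun i => (G.rho S i : ℂ)} :=
      Submodule.sum_mem _ fun S _ => Submodule.smul_mem _ _ (Submodule.subset_span ⟨S.1, S.2, rfl⟩)
    have hy' : y ∈ G.stationary :=
      Submodule.sum_mem _ fun S _ => Submodule.smul_mem _ _ S.2.rho_mem_stationary
    have hval : ∀ S, (x - y) (i S) = 0 := by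
      intro S
      have h1 : y (i S) = x (i S) / G.rho S.1 (i S) * G.rho S.1 (i S) := by
        simp only [y, Finset.sum_apply, Pi.smul_apply, smul_eq_mul]
        refine Finset.sum_eq_single S (fun S' _ hS' => ?_) (by simp)
        have : i S ∉ S'.1 := fun h => hS' (Subtype.ext
          ((S'.2.1.eq_component h).trans (S.2.1.eq_component (hi S)).symm))
        rw [rho_of_notMem this, Complex.ofReal_zero, mul_zero]
      rw [Pi.sub_apply, h1, div_mul_cancel₀ _
        (Complex.ofReal_ne_zero.2 (S.2.1.1.rho_ne_zero (hi S))), sub_self]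
    have hxy : x - y = 0 := by
      funext j
      by_contra hj
      obtain ⟨S, hS, b, hb, hjb⟩ := exists_isTSCC_reachable (G := G) j
      exact ne_zero_of_reachable (sub_mem hx hy')
        (hjb.trans (hS.1.1.reachable hb (hi ⟨S, hS⟩))) hj (hval ⟨S, hS⟩)
    rwa [sub_eq_zero.1 hxy]
  · rintro _ ⟨S, hS, rfl⟩
    exact hS.rho_mem_stationary

end Stationary

end WeightedDigraph

/-! ### Standard forms -/

section StandardForm

variable {N : ℕ} {L : Module.End ℂ (Matrix (Fin N) (Fin N) ℂ)}

lemma IsStandardForm.trace_apply {H : Matrix (Fin N) (Fin N) ℂ}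
    {Γ : Matrix (Fin N × Fin N) (Fin N × Fin N) ℂ} (h : IsStandardForm L H Γ)
    (ρ : Matrix (Fin N) (Fin N) ℂ) : (L ρ).trace = 0 := by
  have hc : ∀ A B : Matrix (Fin N) (Fin N) ℂ, (⁅A, B⁆).trace = 0 := fun A B => by
    rw [Ring.lie_def, Matrix.trace_sub, Matrix.trace_mul_comm, sub_self]
  simp [h.eq ρ, Matrix.trace_add, Matrix.trace_smul, Matrix.trace_sum, hc]

/-- Only the sandwich term `E_ab E_jj E_cd*` reaches the `(i,i)` entry, and it occurs twice; the
other products have `E_jj` at an outer end. -/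
lemma lie_matUnit_apply {i j : Fin N} (hij : i ≠ j) (a b c d : Fin N) :
    (⁅matUnit a b, matUnit j j * (matUnit c d)ᴴ⁆ + ⁅matUnit a b * matUnit j j, (matUnit c d)ᴴ⁆) i i
      = if c = i ∧ d = j then (if a = i ∧ b = j then (2 : ℂ) else 0) else 0 := by
  have h1 : ∀ M : Matrix (Fin N) (Fin N) ℂ, (matUnit j j * M) i i = 0 := fun M =>
    Matrix.single_mul_apply_of_ne _ _ _ _ _ hij M
  have h2 : ∀ M : Matrix (Fin N) (Fin N) ℂ, (M * matUnit j j) i i = 0 := fun M =>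
    Matrix.mul_single_apply_of_ne _ _ _ _ _ hij M
  have h3 : (matUnit a b * matUnit j j * (matUnit c d)ᴴ : Matrix (Fin N) (Fin N) ℂ) i i =
      if c = i ∧ d = j then (if a = i ∧ b = j then 1 else 0) else 0 := by
    by_cases hb : b = j
    · subst hb
      by_cases hd : d = b
      · subst hd
        by_cases hc : c = i <;> by_cases ha : a = i <;> simp [matUnit, hc, ha]
      · simp [matUnit, hd, Ne.symm hd]
    · simp [matUnit, hb]
  rw [Ring.lie_def, Ring.lie_def, Matrix.add_apply, Matrix.sub_apply, Matrix.sub_apply,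
    Matrix.mul_assoc (matUnit j j), h1, ← Matrix.mul_assoc _ (matUnit a b), h2,
    ← Matrix.mul_assoc (matUnit a b), h3]
  split_ifs <;> norm_num

/-- The right side is thereby independent of the chosen form, which makes the digraph well defined.
-/
lemma IsStandardForm.coeff_eq {H : Matrix (Fin N) (Fin N) ℂ}
    {Γ : Matrix (Fin N × Fin N) (Fin N × Fin N) ℂ} (h : IsStandardForm L H Γ) {i j : Fin N}
    (hij : i ≠ j) : L (matUnit j j) i i = Γ (i, j) (i, j) := by
  have hH : ⁅H, matUnit j j⁆ i i = 0 := by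
    simp [Ring.lie_def, matUnit, Matrix.mul_apply, hij.symm]
  rw [h.eq]
  simp only [Matrix.add_apply, Matrix.smul_apply, Matrix.sum_apply, lie_matUnit_apply hij, hH]
  simp only [ite_and, smul_eq_mul, mul_ite, mul_zero, Finset.sum_ite_eq',
    Finset.mem_univ, if_true, Finset.sum_ite_irrel, Finset.sum_const_zero]
  ring

lemma IsStandardForm.coeff_nonneg {H : Matrix (Fin N) (Fin N) ℂ}
    {Γ : Matrix (Fin N × Fin N) (Fin N × Fin N) ℂ} (h : IsStandardForm L H Γ) {i j : Fin N}
    (hij : i ≠ j) : 0 ≤ Γ (i, j) (i, j) := by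
  have := h.pos (matUnit i j) (by simp [matUnit, Matrix.trace_single_eq_of_ne _ _ _ hij])
  convert this using 1
  simp [Matrix.trace, matUnit, coeffAct, Matrix.mul_apply, Matrix.single_apply, ite_and]

/-- The coefficients of `L` in `L(ρ) = ∑ γ_{ijkl} E_{ij} ρ E_{kl}*`. -/
def choiCoeff (L : Module.End ℂ (Matrix (Fin N) (Fin N) ℂ)) :
    Matrix (Fin N × Fin N) (Fin N × Fin N) ℂ :=
  Matrix.of fun p q => L (matUnit p.2 q.2) p.1 q.1

lemma IsCompletelyPositive.choiCoeff_posSemidef (h : IsCompletelyPositive L) :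
    (choiCoeff L).PosSemidef := by
  -- This is Choi's argument: the ampliation is applied to the rank-one projector, up to scale, on
  -- `∑ e_k ⊗ e_k`.
  have h1 := h N _ (Matrix.posSemidef_vecMulVec_self_star
    (fun p : Fin N × Fin N => if p.1 = p.2 then (1 : ℂ) else 0))
  have h2 := h1.submatrix (Prod.swap : Fin N × Fin N → Fin N × Fin N)
  convert h2 using 1
  ext p q
  simp only [choiCoeff, ampliation, Matrix.of_apply, Matrix.submatrix_apply, Prod.fst_swap,
    Prod.snd_swap, matUnit]
  refine congrArg (fun M => L M p.1 q.1) ?_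
  ext k l
  simp only [Matrix.vecMulVec_apply, Matrix.single_apply, Matrix.of_apply, Pi.star_apply]
  by_cases h1 : p.2 = k <;> by_cases h2 : q.2 = l <;> simp [h1, h2]

lemma trace_mul_coeffAct (Γ : Matrix (Fin N × Fin N) (Fin N × Fin N) ℂ)
    (A B : Matrix (Fin N) (Fin N) ℂ) :
    (Bᴴ * coeffAct Γ A).trace =
      star (fun p : Fin N × Fin N => B p.1 p.2) ⬝ᵥ (Γ *ᵥ fun p : Fin N × Fin N => A p.1 p.2) := by
  simp only [Matrix.trace, Matrix.diag_apply, Matrix.mul_apply, Matrix.conjTranspose_apply,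
    coeffAct, Matrix.of_apply, dotProduct, Matrix.mulVec, Fintype.sum_prod_type, Pi.star_apply]
  exact Finset.sum_comm

open Filter in
lemma IsQDSGenerator.choiCoeff_tendsto (hL : IsQDSGenerator L) :
    ∃ T : ℝ≥0 → Module.End ℂ (Matrix (Fin N) (Fin N) ℂ), IsQDS T ∧
      ∀ p q, Tendsto (fun t : ℝ≥0 => (t : ℝ)⁻¹ • (choiCoeff (T t) p q - choiCoeff LinearMap.id p q))
        (𝓝[>] 0) (𝓝 (choiCoeff L p q)) := by
  obtain ⟨T, hT, hlim⟩ := hL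
  refine ⟨T, hT, fun p q => ?_⟩
  have := ((hlim (matUnit p.2 q.2)).apply_nhds p.1).apply_nhds q.1
  exact this

lemma IsQDSGenerator.trace_apply (hL : IsQDSGenerator L) (x : Matrix (Fin N) (Fin N) ℂ) :
    (L x).trace = 0 := by
  obtain ⟨T, hT, hlim⟩ := hL
  have h1 : Filter.Tendsto (fun t : ℝ≥0 => ((t : ℝ)⁻¹ • (T t x - x)).trace) (𝓝[>] 0)
      (𝓝 (L x).trace) :=
    ((continuous_id.matrix_trace).tendsto (L x)).comp (hlim x)
  simp only [Matrix.trace_smul, Matrix.trace_sub, hT.trace, sub_self, smul_zero] at h1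
  exact tendsto_nhds_unique h1 tendsto_const_nhds

lemma IsQDSGenerator.choiCoeff_isHermitian (hL : IsQDSGenerator L) :
    (choiCoeff L).IsHermitian := by
  obtain ⟨T, hT, hlim⟩ := hL.choiCoeff_tendsto
  ext p q
  rw [Matrix.conjTranspose_apply]
  refine tendsto_nhds_unique ((hlim q p).star) ((hlim p q).congr fun t => ?_)
  have h1 := ((hT.cp t).choiCoeff_posSemidef.isHermitian).apply p q
  have h2 := ((hT.cp 0).choiCoeff_posSemidef.isHermitian).apply p q
  rw [hT.zero] at h2
  rw [star_smul, star_sub, h1, h2]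
  simp

lemma IsQDSGenerator.choiCoeff_pos (hL : IsQDSGenerator L) {A : Matrix (Fin N) (Fin N) ℂ}
    (hA : A.trace = 0) : 0 ≤ (Aᴴ * coeffAct (choiCoeff L) A).trace := by
  obtain ⟨T, hT, hlim⟩ := hL.choiCoeff_tendsto
  -- The coefficient operator of the identity map is `A ↦ Tr(A) I`, so subtracting it costs nothing
  -- on traceless matrices.
  have hid : coeffAct (choiCoeff LinearMap.id) A = 0 := by
    ext i j
    have : ∑ k, A k k = 0 := hA
    simp [coeffAct, choiCoeff, matUnit, Matrix.single_apply, ite_and, this]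
  have h1 : Filter.Tendsto (fun t : ℝ≥0 => (t : ℝ)⁻¹ • (Aᴴ * coeffAct (choiCoeff (T t)) A).trace)
      (𝓝[>] 0) (𝓝 (Aᴴ * coeffAct (choiCoeff L) A).trace) := by
    have h2 : Filter.Tendsto (fun t : ℝ≥0 => (Aᴴ * coeffAct ((t : ℝ)⁻¹ •
        (choiCoeff (T t) - choiCoeff LinearMap.id)) A).trace)
        (𝓝[>] 0) (𝓝 (Aᴴ * coeffAct (choiCoeff L) A).trace) := by
      simp only [trace_mul_coeffAct, dotProduct, Matrix.mulVec]
      exact tendsto_finsetSum _ fun p _ => (tendsto_finsetSum _ fun q _ =>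
        (hlim p q).mul_const _).const_mul _
    refine h2.congr fun t => ?_
    have h3 := trace_mul_coeffAct (choiCoeff LinearMap.id) A A
    rw [hid, Matrix.mul_zero, Matrix.trace_zero] at h3
    rw [trace_mul_coeffAct, Matrix.smul_mulVec, Matrix.sub_mulVec, dotProduct_smul,
      dotProduct_sub, ← h3, sub_zero, trace_mul_coeffAct]
  refine ge_of_tendsto' h1 fun t => ?_
  rw [trace_mul_coeffAct]
  exact smul_nonneg (inv_nonneg.2 t.2) ((hT.cp t).choiCoeff_posSemidef.dotProduct_mulVec_nonneg _)

lemma sum_choiCoeff_smul (ρ : Matrix (Fin N) (Fin N) ℂ) :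
    ∑ i, ∑ j, ∑ k, ∑ l, choiCoeff L (i, j) (k, l) • (matUnit i j * ρ * (matUnit k l)ᴴ) = L ρ := by
  have hρ : ρ = ∑ j, ∑ l, ρ j l • matUnit j l := by
    conv_lhs => rw [Matrix.matrix_eq_sum_single ρ]
    simp [matUnit, Matrix.smul_single]
  have hu : ∀ i j k l : Fin N, matUnit i j * ρ * (matUnit k l)ᴴ = ρ j l • matUnit i k := by
    intro i j k l
    simp [matUnit, Matrix.smul_single]
  have hLu : ∀ A : Matrix (Fin N) (Fin N) ℂ, A = ∑ i, ∑ k, A i k • matUnit i k := by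
    intro A
    conv_lhs => rw [Matrix.matrix_eq_sum_single A]
    simp [matUnit, Matrix.smul_single]
  simp only [hu]
  conv_rhs => rw [hρ]
  simp only [map_sum, map_smul]
  calc _ = ∑ i, ∑ j, ∑ l, ∑ k, choiCoeff L (i, j) (k, l) • ρ j l • matUnit i k :=
        Finset.sum_congr rfl fun i _ => Finset.sum_congr rfl fun j _ => Finset.sum_comm
    _ = ∑ j, ∑ i, ∑ l, ∑ k, choiCoeff L (i, j) (k, l) • ρ j l • matUnit i k := Finset.sum_comm
    _ = ∑ j, ∑ l, ∑ i, ∑ k, choiCoeff L (i, j) (k, l) • ρ j l • matUnit i k :=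
        Finset.sum_congr rfl fun j _ => Finset.sum_comm
    _ = _ := by
      refine Finset.sum_congr rfl fun j _ => Finset.sum_congr rfl fun l _ => ?_
      conv_rhs => rw [hLu (L (matUnit j l))]
      simp only [Finset.smul_sum]
      refine Finset.sum_congr rfl fun i _ => Finset.sum_congr rfl fun k _ => ?_
      rw [smul_comm]
      rfl

/-- The coefficient of `E_lj` in the sum is the trace of `L(E_jl)`. -/
lemma sum_choiCoeff_smul_mul (htr : ∀ x, (L x).trace = 0) :
    ∑ i, ∑ j, ∑ k, ∑ l, choiCoeff L (i, j) (k, l) •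
      ((matUnit k l)ᴴ * matUnit i j : Matrix (Fin N) (Fin N) ℂ) = 0 := by
  have hu : ∀ i j k l : Fin N, ((matUnit k l)ᴴ * matUnit i j : Matrix (Fin N) (Fin N) ℂ) =
      if k = i then matUnit l j else 0 := by
    intro i j k l
    split_ifs with h
    · simp [matUnit, h]
    · simp [matUnit, h]
  simp only [hu, smul_ite, smul_zero]
  calc _ = ∑ i, ∑ j, ∑ l, choiCoeff L (i, j) (i, l) • (matUnit l j : Matrix (Fin N) (Fin N) ℂ) := by
        simp [Finset.sum_ite_irrel]
    _ = ∑ j, ∑ i, ∑ l, choiCoeff L (i, j) (i, l) • (matUnit l j : Matrix (Fin N) (Fin N) ℂ) :=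
        Finset.sum_comm
    _ = ∑ j, ∑ l, ∑ i, choiCoeff L (i, j) (i, l) • (matUnit l j : Matrix (Fin N) (Fin N) ℂ) :=
        Finset.sum_congr rfl fun j _ => Finset.sum_comm
    _ = 0 := by
      refine Finset.sum_eq_zero fun j _ => Finset.sum_eq_zero fun l _ => ?_
      rw [← Finset.sum_smul]
      have : ∑ i, choiCoeff L (i, j) (i, l) = 0 := htr (matUnit j l)
      rw [this, zero_smul]

lemma IsQDSGenerator.isStandardForm (hL : IsQDSGenerator L) :
    IsStandardForm L 0 (choiCoeff L) where
  hermitian := Matrix.isHermitian_zero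
  pos _ hA := hL.choiCoeff_pos hA
  re_trace A hA := by
    have h1 := trace_mul_coeffAct (choiCoeff L) A 1
    have h2 := trace_mul_coeffAct (choiCoeff L) 1 A
    rw [Matrix.conjTranspose_one, Matrix.one_mul] at h1
    rw [hA.eq, Matrix.trace_mul_comm] at h2
    -- Since the Choi matrix is Hermitian, the two traces are complex conjugates.
    rw [h1, h2, ← Complex.conj_re (star _ ⬝ᵥ _)]
    congr 1
    change star _ = _
    rw [Matrix.star_dotProduct, star_star, Matrix.star_mulVec, hL.choiCoeff_isHermitian.eq,
      Matrix.dotProduct_mulVec, dotProduct_comm]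
  eq ρ := by
    have hterm : ∀ i j k l : Fin N, choiCoeff L (i, j) (k, l) •
        (⁅matUnit i j, ρ * (matUnit k l)ᴴ⁆ + ⁅matUnit i j * ρ, (matUnit k l)ᴴ⁆) =
        (2 : ℂ) • choiCoeff L (i, j) (k, l) • (matUnit i j * ρ * (matUnit k l)ᴴ)
        - ρ * (choiCoeff L (i, j) (k, l) • ((matUnit k l)ᴴ * matUnit i j))
        - (choiCoeff L (i, j) (k, l) • ((matUnit k l)ᴴ * matUnit i j)) * ρ := by
      intro i j k l
      rw [Ring.lie_def, Ring.lie_def, Matrix.mul_smul, Matrix.smul_mul, smul_comm (2 : ℂ),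
        ← smul_sub, ← smul_sub, two_smul]
      simp only [Matrix.mul_assoc]
      congr 1
      abel
    simp only [hterm, Finset.sum_sub_distrib, ← Finset.smul_sum, ← Finset.mul_sum,
      ← Finset.sum_mul, sum_choiCoeff_smul, sum_choiCoeff_smul_mul hL.trace_apply]
    simp [Ring.lie_def]

/-- The digraph with the weights `γ_{ij} = γ_{ijij}`. -/
def IsStandardForm.digraph {H : Matrix (Fin N) (Fin N) ℂ}
    {Γ : Matrix (Fin N × Fin N) (Fin N × Fin N) ℂ} (h : IsStandardForm L H Γ) :
    WeightedDigraph N where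
  w i j := if i = j then 0 else (Γ (i, j) (i, j)).re
  nonneg i j := by
    split_ifs with hij
    · exact le_rfl
    · exact (Complex.nonneg_iff.1 (h.coeff_nonneg hij)).1
  loopless i := if_pos rfl

lemma IsInducedDigraph.w_eq {G : WeightedDigraph N} (h : IsInducedDigraph L G) {i j : Fin N}
    (hij : i ≠ j) : (G.w i j : ℂ) = L (matUnit j j) i i := by
  obtain ⟨H, Γ, hΓ, hw⟩ := h
  rw [hw i j hij, hΓ.coeff_eq hij]

lemma IsQDSGenerator.existsUnique_digraph (hL : IsQDSGenerator L) :
    ∃! G : WeightedDigraph N, IsInducedDigraph L G := by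
  refine ⟨hL.isStandardForm.digraph, ⟨_, _, hL.isStandardForm, fun i j hij => ?_⟩, fun G hG => ?_⟩
  · simp only [IsStandardForm.digraph, if_neg hij]
    exact Complex.ext rfl (Complex.nonneg_iff.1 (hL.isStandardForm.coeff_nonneg hij)).2
  · ext i j
    by_cases hij : i = j
    · subst hij
      rw [G.loopless, WeightedDigraph.loopless]
    · have h1 := hG.w_eq hij
      rw [hL.isStandardForm.coeff_eq hij] at h1
      simp only [IsStandardForm.digraph, if_neg hij, ← h1, Complex.ofReal_re]

end StandardForm

/-! ### The kernel of the diagonal part -/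

section DiagonalPart

variable {N : ℕ} {L : Module.End ℂ (Matrix (Fin N) (Fin N) ℂ)}

lemma sum_smul_matUnit (x : Fin N → ℂ) : ∑ n, x n • matUnit n n = Matrix.diagonal x := by
  ext i j
  rw [Matrix.sum_apply, Matrix.diagonal_apply]
  by_cases hij : i = j
  · subst hij
    simp [matUnit, Matrix.single_apply]
  · rw [if_neg hij]
    refine Finset.sum_eq_zero fun n _ => ?_
    have : ¬ (n = i ∧ n = j) := fun h => hij (h.1.symm.trans h.2)
    simp [matUnit, this]

lemma mem_diagSubspace {A : Matrix (Fin N) (Fin N) ℂ} :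
    A ∈ diagSubspace N ↔ ∃ x, Matrix.diagonal x = A := by
  simp only [diagSubspace, Submodule.mem_span_range_iff_exists_fun, sum_smul_matUnit]

lemma coe_diagProj (A : Matrix (Fin N) (Fin N) ℂ) :
    (diagProj N A : Matrix (Fin N) (Fin N) ℂ) = Matrix.diagonal fun n => A n n := by
  rw [← sum_smul_matUnit]
  simp [diagProj]

lemma IsInducedDigraph.apply_diagonal {G : WeightedDigraph N} (h : IsInducedDigraph L G)
    (x : Fin N → ℂ) (i : Fin N) :
    L (Matrix.diagonal x) i i =
      ∑ j, (G.w i j : ℂ) * x j - (∑ k, (G.w k i : ℂ)) * x i := by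
  classical
  -- The diagonal coefficient never needs `Γ`: the zero trace of `L(E_ii)` determines it from the
  -- outgoing weights.
  have hself : L (matUnit i i) i i = -∑ k, (G.w k i : ℂ) := by
    have htr : (L (matUnit i i)).trace = 0 := by
      obtain ⟨H, Γ, hΓ, -⟩ := h
      exact hΓ.trace_apply _
    rw [Matrix.trace, ← Finset.add_sum_erase _ _ (Finset.mem_univ i)] at htr
    rw [← Finset.add_sum_erase _ _ (Finset.mem_univ i), G.loopless, Complex.ofReal_zero, zero_add,
      eq_neg_iff_add_eq_zero, ← htr]
    congr 1
    exact Finset.sum_congr rfl fun k hk => h.w_eq (Finset.ne_of_mem_erase hk)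
  rw [← sum_smul_matUnit, map_sum, Matrix.sum_apply,
    ← Finset.add_sum_erase _ _ (Finset.mem_univ i),
    ← Finset.add_sum_erase _ (fun j => (G.w i j : ℂ) * x j) (Finset.mem_univ i), G.loopless,
    map_smul, Matrix.smul_apply, hself]
  have : ∑ j ∈ Finset.univ.erase i, L (x j • matUnit j j) i i =
      ∑ j ∈ Finset.univ.erase i, (G.w i j : ℂ) * x j := by
    refine Finset.sum_congr rfl fun j hj => ?_
    rw [map_smul, Matrix.smul_apply, h.w_eq (Finset.ne_of_mem_erase hj).symm, smul_eq_mul, mul_comm]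
  rw [this]
  simp only [smul_eq_mul, Complex.ofReal_zero]
  ring

lemma IsInducedDigraph.map_ker_diagPart {G : WeightedDigraph N} (h : IsInducedDigraph L G) :
    (LinearMap.ker (diagPart L)).map (diagSubspace N).subtype =
      G.stationary.map (Matrix.diagonalLinearMap (Fin N) ℂ ℂ) := by
  have key : ∀ (x : Fin N → ℂ) (hx : Matrix.diagonal x ∈ diagSubspace N),
      (⟨Matrix.diagonal x, hx⟩ : diagSubspace N) ∈ LinearMap.ker (diagPart L) ↔
        x ∈ G.stationary := by
    intro x hx
    rw [LinearMap.mem_ker, ← Submodule.coe_eq_zero, WeightedDigraph.mem_stationary]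
    change (diagProj N (L (Matrix.diagonal x)) : Matrix (Fin N) (Fin N) ℂ) = 0 ↔ _
    simp only [coe_diagProj, Matrix.diagonal_eq_zero, funext_iff, Pi.zero_apply, h.apply_diagonal,
      sub_eq_zero]
  ext A
  simp only [Submodule.mem_map, Submodule.subtype_apply]
  constructor
  · rintro ⟨⟨B, hB⟩, hker, rfl⟩
    obtain ⟨x, rfl⟩ := mem_diagSubspace.1 hB
    exact ⟨x, (key x hB).1 hker, rfl⟩
  · rintro ⟨x, hx, rfl⟩
    exact ⟨⟨Matrix.diagonal x, mem_diagSubspace.2 ⟨x, rfl⟩⟩, (key x _).2 hx, rfl⟩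

end DiagonalPart

theorem mainTheorem8 (N : ℕ) (L : Module.End ℂ (Matrix (Fin N) (Fin N) ℂ))
    (hL : IsQDSGenerator L) :
    (∃! G : WeightedDigraph N, IsInducedDigraph L G) ∧
    ∀ G : WeightedDigraph N, IsInducedDigraph L G →
      (LinearMap.ker (diagPart L)).map (diagSubspace N).subtype =
        Submodule.span ℂ {d | ∃ S, G.IsTSCC S ∧ d = G.diagMatrix S} := by
  refine ⟨hL.existsUnique_digraph, fun G hG => ?_⟩
  rw [hG.map_ker_diagPart, G.stationary_eq_span, Submodule.map_span]
  congr 1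
  ext d
  constructor
  · rintro ⟨_, ⟨S, hS, rfl⟩, rfl⟩
    exact ⟨S, hS, (sum_smul_matUnit _).symm⟩
  · rintro ⟨S, hS, rfl⟩
    exact ⟨_, ⟨S, hS, rfl⟩, (sum_smul_matUnit _).symm⟩
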